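/- Let $R$ be a ring and let $\mathcal I$ be an ideal of homomorphisms of left $R$-modules, i.e. an additive subfunctor of the bifunctor $\operatorname{Hom}_R$ (it contains all zero maps, is closed under sums of parallel homomorphisms, and $f\circ g\circ h\in\mathcal I$ whenever $g\in\mathcal I$ and $f,h$ are composable homomorphisms). Suppose that $\mathcal I$ is generated in the extended sense by a set $(f_s\colon M_s\to N_s)_{s\in S}$ of homomorphisms, that is, $f_s\in\mathcal I$ for all $s\in S$, and every $\varphi\colon U\to V$ in $\mathcal I$ has a factorization $$U\longrightarrow \bigoplus_{s\in S}M_s^{(\kappa_s)}\xrightarrow{\ \bigoplus_s f_s^{(\kappa_s)}\ }\bigoplus_{s\in S}N_s^{(\kappa_s)}\longrightarrow V$$ for some (possibly infinite, possibly zero) cardinals $\kappa_s$, where $X^{(\kappa)}$ denotes the direct sum of $\kappa$ copies of $X$. (This includes the case in which $\mathcal I$ consists of all homomorphisms with such a factorization.) Let $$\mathcal I^\perp=\{\,j : \operatorname{Ext}^1_R(i,j)=0\text{ for all } i\in\mathcal I\,\},$$ where for $i\colon A\to B$ and $j\colon U\to V$ the condition $\operatorname{Ext}^1_R(i,j)=0$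 means that the induced map $\operatorname{Ext}^1_R(B,U)\to\operatorname{Ext}^1_R(A,V)$ is zero. Then $\mathcal I^\perp$ is a preenveloping ideal: it is an ideal, and every left $R$-module $U$ has an $\mathcal I^\perp$-preenvelope, i.e. a homomorphism $j\colon U\to V$ in $\mathcal I^\perp$ such that every $j'\colon U\to V'$ in $\mathcal I^\perp$ is of the form $j'=t\circ j$ for some homomorphism $t\colon V\to V'$. -/

import Mathlib

open CategoryTheory CategoryTheory.Limits CategoryTheory.Abelian

universe u

/-- An ideal of `R`-homomorphisms: an additive subfunctor of the bifunctor `Hom` on the category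
of all left `R`-modules. -/
structure HomIdeal (R : Type u) [Ring R] where
  /-- the predicate of belonging to the ideal -/
  mem : MorphismProperty (ModuleCat.{u} R)
  zero_mem : ∀ A B : ModuleCat.{u} R, mem (0 : A ⟶ B)
  add_mem : ∀ {A B : ModuleCat.{u} R} {g h : A ⟶ B}, mem g → mem h → mem (g + h)
  comp_mem : ∀ {A B C D : ModuleCat.{u} R} (h : A ⟶ B) {g : B ⟶ C} (f : C ⟶ D),
    mem g → mem (h ≫ g ≫ f)

/-- `Ext¹(i, j) = 0` for `i : A ⟶ B` and `j : U ⟶ V`: the map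
`Ext¹(B, U) → Ext¹(A, V)`, pullback along `i` and pushout along `j`, is zero. -/
def ExtVanishes {R : Type u} [Ring R] {A B U V : ModuleCat.{u} R} (i : A ⟶ B) (j : U ⟶ V) :
    Prop :=
  ∀ ξ : Ext B U 1,
    ((Ext.mk₀ i).comp (ξ.comp (Ext.mk₀ j) (add_zero 1)) (zero_add 1) : Ext A V 1) = 0

/-- The ideal `I^⊥` of all `j` with `Ext¹(i, j) = 0` for all `i` in `I`. -/
def HomIdeal.perp {R : Type u} [Ring R] (I : HomIdeal R) : HomIdeal R where
  mem := fun _ _ j => ∀ ⦃A B : ModuleCat.{u} R⦄ (i : A ⟶ B), I.mem i → ExtVanishes i j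
  zero_mem := by
    intro U V A B i _ ξ
    simp
  add_mem := by
    intro U V g h hg hh A B i hi ξ
    rw [Ext.mk₀_add, Ext.comp_add, Ext.comp_add, hg i hi ξ, hh i hi ξ, add_zero]
  comp_mem := by
    intro U U' V V' h g f hg A B i hi ξ
    have key := hg i hi (ξ.comp (Ext.mk₀ h) (add_zero 1))
    have e : (Ext.mk₀ i).comp (ξ.comp (Ext.mk₀ (h ≫ g ≫ f)) (add_zero 1)) (zero_add 1) =
        ((Ext.mk₀ i).comp ((ξ.comp (Ext.mk₀ h) (add_zero 1)).comp (Ext.mk₀ g) (add_zero 1))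
          (zero_add 1)).comp (Ext.mk₀ f) (add_zero 1) := by
      rw [← Ext.mk₀_comp_mk₀, ← Ext.mk₀_comp_mk₀]
      simp only [Ext.comp_assoc_of_third_deg_zero]
    rw [e, key, Ext.zero_comp]

/-- `j : U ⟶ V` is a `J`-preenvelope of `U`. -/
def HomIdeal.IsPreenvelope {R : Type u} [Ring R] (J : HomIdeal R) {U V : ModuleCat.{u} R}
    (j : U ⟶ V) : Prop :=
  J.mem j ∧ ∀ ⦃V' : ModuleCat.{u} R⦄ (j' : U ⟶ V'), J.mem j' → ∃ t : V ⟶ V', j ≫ t = j'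

/-- `J` is preenveloping: every module has a `J`-preenvelope. -/
def HomIdeal.IsPreenveloping {R : Type u} [Ring R] (J : HomIdeal R) : Prop :=
  ∀ U : ModuleCat.{u} R, ∃ (V : ModuleCat.{u} R) (j : U ⟶ V), J.IsPreenvelope j

/-- `φ` has a factorization `U ⟶ ⨁ₛ Mₛ^(κₛ) ⟶ ⨁ₛ Nₛ^(κₛ) ⟶ V` with middle map the direct sum of
copies of the `fₛ`. The direct sums are indexed by the pairs of an `s` and an element of
an index type `κ s`; these types are arbitrary, possibly empty. -/
def FactorsThroughSums {R : Type u} [Ring R] {S : Type u} {M N : S → ModuleCat.{u} R}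
    (f : ∀ s, M s ⟶ N s) {U V : ModuleCat.{u} R} (φ : U ⟶ V) : Prop :=
  ∃ (κ : S → Type u) (a : U ⟶ ∐ fun p : (Σ s, κ s) => M p.1)
    (b : (∐ fun p : (Σ s, κ s) => N p.1) ⟶ V),
    φ = a ≫ Limits.Sigma.map (fun p : (Σ s, κ s) => f p.1) ≫ b

/-- `I` is generated by the set `(fₛ)` of homomorphisms in the extended sense: the generators
belong to `I`, and every element of `I` factors through a direct sum of copies of them. -/
def HomIdeal.GeneratedInExtendedSense {R : Type u} [Ring R] (I : HomIdeal R) {S : Type u}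
    {M N : S → ModuleCat.{u} R} (f : ∀ s, M s ⟶ N s) : Prop :=
  (∀ s, I.mem (f s)) ∧
    ∀ ⦃U V : ModuleCat.{u} R⦄ (φ : U ⟶ V), I.mem φ → FactorsThroughSums f φ

section ExtOne

variable {C : Type*} [Category C] [Abelian C] [HasExt C]

/-- A class in `Ext¹(∐ X, Y)` vanishes if its restriction to each summand does. -/
theorem ext_one_eq_zero_of_sigma_ι_comp [EnoughInjectives C] {ι : Type*} (X : ι → C)
    [HasCoproduct X] {Y : C} (ζ : Ext (∐ X) Y 1)
    (h : ∀ k, (Ext.mk₀ (Limits.Sigma.ι X k)).comp ζ (zero_add 1) = 0) : ζ = 0 := by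
  let T : ShortComplex C := ShortComplex.mk (Injective.ι Y) (cokernel.π (Injective.ι Y)) (by simp)
  have hT : T.ShortExact :=
    { exact := ShortComplex.exact_cokernel _
      mono_f := inferInstanceAs (Mono (Injective.ι Y))
      epi_g := inferInstanceAs (Epi (cokernel.π _)) }
  have : Injective T.X₂ := inferInstanceAs (Injective (Injective.under Y))
  obtain ⟨x, hx⟩ := Ext.covariant_sequence_exact₁ (∐ X) hT ζ (Ext.eq_zero_of_injective _) rfl
  obtain ⟨g, rfl⟩ := (Ext.mk₀_bijective _ _).2 x
  have lift : ∀ k, ∃ l : X k ⟶ T.X₂, l ≫ T.g = Limits.Sigma.ι X k ≫ g := by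
    intro k
    obtain ⟨y, hy⟩ := Ext.covariant_sequence_exact₃ (X k) hT
      (Ext.mk₀ (Limits.Sigma.ι X k ≫ g)) (zero_add 1) (by
        rw [← Ext.mk₀_comp_mk₀, Ext.comp_assoc_of_second_deg_zero, hx, h k])
    obtain ⟨l, rfl⟩ := (Ext.mk₀_bijective _ _).2 y
    exact ⟨l, (Ext.mk₀_bijective _ _).1 (by rw [← Ext.mk₀_comp_mk₀, hy])⟩
  choose l hl using lift
  have hg : g = Limits.Sigma.desc l ≫ T.g := by
    apply Limits.Sigma.hom_ext
    intro k
    rw [Limits.Sigma.ι_desc_assoc, hl]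
  rw [← hx, hg, ← Ext.mk₀_comp_mk₀, Ext.comp_assoc_of_second_deg_zero, hT.comp_extClass,
    Ext.comp_zero]

/-- For `T` with projective middle term, `g : T.X₁ ⟶ U` and `j : U ⟶ V`, the pushout along `j` of
the class in `Ext¹(T.X₃, U)` given by `g` vanishes iff `g ≫ j` extends to `T.X₂`. -/
theorem extClass_comp_mk₀_comp_mk₀_eq_zero_iff {T : ShortComplex C} (hT : T.ShortExact)
    {U V : C} (g : T.X₁ ⟶ U) (j : U ⟶ V) :
    (hT.extClass.comp (Ext.mk₀ g) (add_zero 1)).comp (Ext.mk₀ j) (add_zero 1) = 0 ↔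
      ∃ e : T.X₂ ⟶ V, T.f ≫ e = g ≫ j := by
  rw [Ext.comp_assoc_of_third_deg_zero, Ext.mk₀_comp_mk₀]
  constructor
  · intro h
    obtain ⟨y, hy⟩ := Ext.contravariant_sequence_exact₁ hT V _ (add_zero 1) h
    obtain ⟨e, rfl⟩ := (Ext.mk₀_bijective _ _).2 y
    exact ⟨e, (Ext.mk₀_bijective _ _).1 (by rw [← Ext.mk₀_comp_mk₀, hy])⟩
  · rintro ⟨e, he⟩
    rw [← he, ← Ext.mk₀_comp_mk₀, hT.extClass_comp_assoc]

/-- A class in `Ext¹(X, U)` is the pushout along some `g : K ⟶ U` of a projective presentation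
`K ⟶ P ⟶ X`; its pushout along `j` vanishes iff `g ≫ j` extends to `P`. -/
theorem exists_comp_mk₀_eq_zero_iff_extends [EnoughProjectives C] {X U : C} (η : Ext X U 1) :
    ∃ (K P : C) (i : K ⟶ P) (g : K ⟶ U), ∀ (V : C) (j : U ⟶ V),
      η.comp (Ext.mk₀ j) (add_zero 1) = 0 ↔ ∃ e : P ⟶ V, i ≫ e = g ≫ j := by
  let T : ShortComplex C := ShortComplex.mk (kernel.ι (Projective.π X)) (Projective.π X) (by simp)
  have hT : T.ShortExact :=
    { exact := ShortComplex.exact_kernel _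
      mono_f := inferInstanceAs (Mono (kernel.ι _))
      epi_g := inferInstanceAs (Epi (Projective.π X)) }
  have : Projective T.X₂ := inferInstanceAs (Projective (Projective.over X))
  obtain ⟨y, hy⟩ := Ext.contravariant_sequence_exact₃ hT U η (Ext.eq_zero_of_projective _)
    (add_zero 1)
  obtain ⟨g, rfl⟩ := (Ext.mk₀_bijective _ _).2 y
  refine ⟨T.X₁, T.X₂, T.f, g, fun V j => ?_⟩
  rw [← hy, extClass_comp_mk₀_comp_mk₀_eq_zero_iff]

/-- There is a weakly universal morphism out of `U` annihilating a given family of classes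
in `Ext¹(X k, U)`. -/
theorem exists_weakly_universal_comp_eq_zero [EnoughProjectives C] {ι : Type*}
    [HasColimitsOfShape (Discrete ι) C] {U : C} {X : ι → C} (η : ∀ k, Ext (X k) U 1) :
    ∃ (V : C) (j : U ⟶ V), (∀ k, (η k).comp (Ext.mk₀ j) (add_zero 1) = 0) ∧
      ∀ ⦃V' : C⦄ (j' : U ⟶ V'), (∀ k, (η k).comp (Ext.mk₀ j') (add_zero 1) = 0) →
        ∃ t : V ⟶ V', j ≫ t = j' := by
  choose K P i g hg using fun k => exists_comp_mk₀_eq_zero_iff_extends (η k)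
  refine ⟨pushout (Limits.Sigma.desc g) (Limits.Sigma.map i), pushout.inl _ _,
    fun k => (hg k _ _).2 ⟨Limits.Sigma.ι P k ≫ pushout.inr _ _, ?_⟩, fun V' j' hj' => ?_⟩
  · have := congrArg (Limits.Sigma.ι K k ≫ ·)
      (pushout.condition (f := Limits.Sigma.desc g) (g := Limits.Sigma.map i))
    simpa using this.symm
  · choose e he using fun k => (hg k _ _).1 (hj' k)
    refine ⟨pushout.desc j' (Limits.Sigma.desc e) ?_, pushout.inl_desc _ _ _⟩
    apply Limits.Sigma.hom_ext
    intro k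
    simp [he]

end ExtOne

/-- Membership in `I^⊥` can be tested on generators of `I`. -/
theorem HomIdeal.GeneratedInExtendedSense.perp_mem_iff {R : Type u} [Ring R] {I : HomIdeal R}
    {S : Type u} {M N : S → ModuleCat.{u} R} {f : ∀ s, M s ⟶ N s}
    (hI : I.GeneratedInExtendedSense f) {U V : ModuleCat.{u} R} (j : U ⟶ V) :
    I.perp.mem j ↔ ∀ s, ExtVanishes (f s) j := by
  refine ⟨fun h s => h _ (hI.1 s), fun h A B i hi ξ => ?_⟩
  obtain ⟨κ, a, b, rfl⟩ := hI.2 i hi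
  have key : (Ext.mk₀ (Limits.Sigma.map (fun p : (Σ s, κ s) => f p.1) ≫ b)).comp
      (ξ.comp (Ext.mk₀ j) (add_zero 1)) (zero_add 1) = 0 := by
    refine ext_one_eq_zero_of_sigma_ι_comp _ _ fun p => ?_
    have hp := h p.1
      ((Ext.mk₀ (Limits.Sigma.ι (fun p : (Σ s, κ s) => N p.1) p ≫ b)).comp ξ (zero_add 1))
    rw [Ext.comp_assoc_of_third_deg_zero, Ext.mk₀_comp_mk₀_assoc] at hp
    rw [Ext.mk₀_comp_mk₀_assoc, Limits.Sigma.ι_map_assoc]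
    exact hp
  rw [← Ext.mk₀_comp_mk₀_assoc, key, Ext.comp_zero]

theorem mainTheorem7 {R : Type u} [Ring R] (I : HomIdeal R) {S : Type u}
    {M N : S → ModuleCat.{u} R} (f : ∀ s, M s ⟶ N s)
    (hI : I.GeneratedInExtendedSense f) :
    I.perp.IsPreenveloping := by
  intro U
  obtain ⟨V, j, hj, huniv⟩ := exists_weakly_universal_comp_eq_zero
    (ι := Σ s, Ext (N s) U 1) (fun k => (Ext.mk₀ (f k.1)).comp k.2 (zero_add 1))
  refine ⟨V, j, (hI.perp_mem_iff j).2 fun s ξ => ?_, fun V' j' hj' => huniv j' fun k => ?_⟩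
  · rw [← Ext.comp_assoc_of_third_deg_zero]
    exact hj ⟨s, ξ⟩
  · rw [Ext.comp_assoc_of_third_deg_zero]
    exact (hI.perp_mem_iff j').1 hj' k.1 k.2
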